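/- **Proposition (PD-Noether theorem).** Let $\alpha:P\to M$ be a smooth fiber bundle, $\dim M=n\ge 1$, $\dim P=n+m$. Let $V\mathrm{D}$ be the module of $\alpha$-vertical smooth vector fields on $P$. For $q\ge 0$ let $\Omega^q$ be the space of affine $q$-forms over $\alpha$, identified, as usual, with the differential $(n-1+q)$-forms on $P$ that vanish whenever at least $q+1$ of their arguments are $\alpha$-vertical; under this identification $\delta:\Omega^q\to\Omega^{q+1}$ is the restriction of the de Rham differential $d$, and $i_Y:\Omega^{q+1}\to\Omega^q$, $Y\in V\mathrm{D}$, is the usual insertion. Let $\omega$ be a PD-prehamiltonian system on $\alpha$, i.e. $\omega\in\Omega^2$ and $\delta\omega=0$. A smooth local section $\sigma:U\to P$ of $\alpha$, $U\subset M$ open, with first jet prolongation $\dot\sigma$, is a solution of the PD-Hamilton equations $i_{\dot\sigma}\omega|_\sigma=0$ if, for all $x\in U$, all vertical $\xi\in T_{\sigma(x)}P$ and all $v_1,\dots,v_n\in T_xM$, $$\omega_{\sigma(x)}\bigl(\xi,\,d\sigma_x v_1,\dots,d\sigma_x v_n\bigr)=0 .$$ Let $Y\in V\mathrm{D}$ and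 $f\in\Omega^0$ be a PD-Noether symmetry and a PD-Noether current of $\omega$ relative to each other, i.e. $i_Y\omega=\delta f$. Then, for every solution $\sigma:U\to P$ of the PD-Hamilton equations, $\sigma^*(f)$ is a smooth closed $(n-1)$-form on $U$ (in particular, on $M$ if $\sigma$ is a global section). -/

import Mathlib

open scoped Manifold ContDiff
open Set

noncomputable section

namespace PDHam

section Forms

variable {E : Type*} [NormedAddCommGroup E] [NormedSpace ℝ E]
variable {M : Type*} [TopologicalSpace M] [ChartedSpace E M]

variable (E M) in
/-- Fields of alternating `k`-forms on the tangent spaces of a manifold `M` (modelled on `E`,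
without boundary); no smoothness is required here, see `IsSmoothOn`. -/
abbrev FormField (k : ℕ) : Type _ :=
  ∀ x : M, TangentSpace 𝓘(ℝ, E) x [⋀^Fin k]→L[ℝ] ℝ

/-- The expression of `w` in the chart `φ` around `x₀`, i.e. the pull-back `(φ⁻¹)^* w`
(meaningful on the target of the chart). -/
def FormField.inChart {k : ℕ} (w : FormField E M k) (x₀ : M) (u : E) : E [⋀^Fin k]→L[ℝ] ℝ :=
  ContinuousAlternatingMap.compContinuousLinearMap (M' := E)
    (w ((extChartAt 𝓘(ℝ, E) x₀).symm u))
    (mfderiv 𝓘(ℝ, E) 𝓘(ℝ, E) (extChartAt 𝓘(ℝ, E) x₀).symm u)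

/-- `w` is a smooth differential form on the open set `U`. -/
def FormField.IsSmoothOn {k : ℕ} (w : FormField E M k) (U : Set M) : Prop :=
  ∀ x₀ : M, ContDiffOn ℝ ∞ (w.inChart x₀)
    ((extChartAt 𝓘(ℝ, E) x₀).target ∩ (extChartAt 𝓘(ℝ, E) x₀).symm ⁻¹' U)

/-- `w` is a differential form, i.e. a smooth form field on the whole manifold. -/
def FormField.IsSmooth {k : ℕ} (w : FormField E M k) : Prop := w.IsSmoothOn univ

/-- The de Rham differential, computed at `x` in the chart around `x`. -/
def FormField.d {k : ℕ} (w : FormField E M k) : FormField E M (k + 1) := fun x ↦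
  ContinuousAlternatingMap.compContinuousLinearMap (M := E)
    (extDeriv (w.inChart x) (extChartAt 𝓘(ℝ, E) x x))
    (mfderiv 𝓘(ℝ, E) 𝓘(ℝ, E) (extChartAt 𝓘(ℝ, E) x) x)

/-- `w` is closed on the open set `U`: it is smooth there, and `dw = 0` there. -/
def FormField.IsClosedOn {k : ℕ} (w : FormField E M k) (U : Set M) : Prop :=
  w.IsSmoothOn U ∧ ∀ x ∈ U, w.d x = 0

/-- Insertion of a tangent vector as the first argument of an alternating form. -/
def contract {k : ℕ} {x : M} (η : TangentSpace 𝓘(ℝ, E) x [⋀^Fin (k + 1)]→L[ℝ] ℝ)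
    (ξ : TangentSpace 𝓘(ℝ, E) x) : TangentSpace 𝓘(ℝ, E) x [⋀^Fin k]→L[ℝ] ℝ :=
  ContinuousAlternatingMap.curryLeft (E := E) η ξ

lemma contract_apply {k : ℕ} {x : M} (η : TangentSpace 𝓘(ℝ, E) x [⋀^Fin (k + 1)]→L[ℝ] ℝ)
    (ξ : TangentSpace 𝓘(ℝ, E) x) (v : Fin k → TangentSpace 𝓘(ℝ, E) x) :
    contract η ξ v = η (Matrix.vecCons ξ v) := rfl

/-- The insertion `i_Y w` of a vector field in a form. -/
def FormField.insert {k : ℕ} (Y : ∀ x : M, TangentSpace 𝓘(ℝ, E) x)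
    (w : FormField E M (k + 1)) : FormField E M k := fun x ↦ contract (w x) (Y x)

/-- `Y` is a smooth vector field. -/
def IsSmoothVectorField [IsManifold 𝓘(ℝ, E) ∞ M]
    (Y : ∀ x : M, TangentSpace 𝓘(ℝ, E) x) : Prop :=
  ContMDiff 𝓘(ℝ, E) 𝓘(ℝ, E).tangent ∞ (fun x ↦ (⟨x, Y x⟩ : TangentBundle 𝓘(ℝ, E) M))

end Forms

variable {B : Type*} [NormedAddCommGroup B] [NormedSpace ℝ B]
variable {E : Type*} [NormedAddCommGroup E] [NormedSpace ℝ E]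
variable {M : Type*} [TopologicalSpace M] [ChartedSpace B M]
variable {P : Type*} [TopologicalSpace P] [ChartedSpace E P]

variable (B) in
/-- The pull-back `σ^* w`. -/
def FormField.pullback {k : ℕ} (σ : M → P) (w : FormField E P k) : FormField B M k := fun x ↦
  (w (σ x)).compContinuousLinearMap (mfderiv 𝓘(ℝ, B) 𝓘(ℝ, E) σ x)

variable (B E) in
/-- `α : P → M` is a smooth (locally trivial) fiber bundle with abstract fiber `F`. -/
structure IsSmoothFiberBundle (G : Type*) [NormedAddCommGroup G] [NormedSpace ℝ G]
    (F : Type*) [TopologicalSpace F] [ChartedSpace G F] (α : P → M) : Prop where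
  smooth : ContMDiff 𝓘(ℝ, E) 𝓘(ℝ, B) ∞ α
  locally_trivial : ∀ x : M, ∃ e : Bundle.Trivialization F α, x ∈ e.baseSet ∧
    ContMDiffOn 𝓘(ℝ, E) (𝓘(ℝ, B).prod 𝓘(ℝ, G)) ∞ e.toOpenPartialHomeomorph e.source ∧
    ContMDiffOn (𝓘(ℝ, B).prod 𝓘(ℝ, G)) 𝓘(ℝ, E) ∞ e.toOpenPartialHomeomorph.symm e.target

variable (B) in
/-- The vertical tangent space `V_y P`. -/
def verticalSpace (α : P → M) (y : P) : Submodule ℝ (TangentSpace 𝓘(ℝ, E) y) :=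
  (mfderiv 𝓘(ℝ, E) 𝓘(ℝ, B) α y).ker

variable (B) in
/-- `Y` is an `α`-vertical smooth vector field, i.e. `Y ∈ VD(P, α)`. -/
def IsVerticalVectorField [IsManifold 𝓘(ℝ, E) ∞ P] (α : P → M)
    (Y : ∀ y : P, TangentSpace 𝓘(ℝ, E) y) : Prop :=
  IsSmoothVectorField Y ∧ ∀ y, Y y ∈ verticalSpace B α y

variable (B) in
/-- `w ∈ Λ_p^k(P, α)`: `w` is a differential `k`-form on `P` which vanishes whenever at least
`k - p + 1` of its arguments are vertical. -/
def MemLambda (α : P → M) (p : ℕ) {k : ℕ} (w : FormField E P k) : Prop :=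
  w.IsSmooth ∧ ∀ (y : P) (v : Fin k → TangentSpace 𝓘(ℝ, E) y) (s : Finset (Fin k)),
    k < s.card + p → (∀ i ∈ s, v i ∈ verticalSpace B α y) → w y v = 0

variable (B) in
/-- Affine `q`-forms over a bundle `α` whose base has dimension `n + 1`, as differential forms
on `P`: `Ω^q = Λ_n^{n+q}`. The differential `δ` of affine forms is the de Rham differential. -/
def IsAffineForm (α : P → M) (n q : ℕ) (w : FormField E P (n + q)) : Prop :=
  MemLambda B α n w

variable (B E) in
/-- The points of the first jet bundle `J¹α` over `y ∈ P`, where `x = α y`: the linear maps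
`c : T_x M → T_y P` with `dα ∘ c = id`. -/
structure FirstJet (α : P → M) (x : M) (y : P) where
  lift : TangentSpace 𝓘(ℝ, B) x →L[ℝ] TangentSpace 𝓘(ℝ, E) y
  proj_eq : α y = x
  mfderiv_lift : ∀ v : B, (mfderiv 𝓘(ℝ, E) 𝓘(ℝ, B) α y (lift v) : B) = v

/-- The insertion `i_c η` of a jet `c` over `y` in (the value at `y` of) an affine 2-form `η`, as
an element of `V_y^* P ⊗ Λ^{k} T_x^* M = Hom(V_y P, Λ^{k} T_x^* M)`, `k = dim M`: the component of
`η` with one vertical and `k` horizontal arguments in the splitting `T_y P = V_y P ⊕ im c`. -/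
def FirstJet.insert {α : P → M} {x : M} {y : P} (c : FirstJet B E α x y) {k : ℕ}
    (η : TangentSpace 𝓘(ℝ, E) y [⋀^Fin (k + 1)]→L[ℝ] ℝ) :
    verticalSpace (E := E) B α y → TangentSpace 𝓘(ℝ, B) x [⋀^Fin k]→L[ℝ] ℝ :=
  fun ξ ↦ (contract η (ξ : TangentSpace 𝓘(ℝ, E) y)).compContinuousLinearMap c.lift

variable (B E) in
/-- Smooth local sections `σ : U → P` of `α`, `U ⊆ M` open; the values of `toFun` outside `U`
are irrelevant. -/
structure LocalSection (α : P → M) where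
  domain : TopologicalSpace.Opens M
  toFun : M → P
  smooth : ContMDiffOn 𝓘(ℝ, B) 𝓘(ℝ, E) ∞ toFun domain
  section_eq : ∀ x ∈ domain, α (toFun x) = x

/-- The first jet prolongation `σ̇` of a local section, at a point of its domain. -/
def LocalSection.jet {α : P → M} (hα : ContMDiff 𝓘(ℝ, E) 𝓘(ℝ, B) ∞ α)
    (σ : LocalSection B E α) (x : M) (hx : x ∈ σ.domain) :
    FirstJet B E α x (σ.toFun x) where
  lift := mfderiv 𝓘(ℝ, B) 𝓘(ℝ, E) σ.toFun x
  proj_eq := σ.section_eq x hx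
  mfderiv_lift := by
    intro v
    have hU : (σ.domain : Set M) ∈ nhds x := σ.domain.isOpen.mem_nhds hx
    have hσ : MDifferentiableAt 𝓘(ℝ, B) 𝓘(ℝ, E) σ.toFun x :=
      (σ.smooth.contMDiffAt hU).mdifferentiableAt (by simp)
    have hα' : MDifferentiableAt 𝓘(ℝ, E) 𝓘(ℝ, B) α (σ.toFun x) :=
      hα.contMDiffAt.mdifferentiableAt (by simp)
    have h1 := mfderiv_comp x hα' hσ
    have h2 : mfderiv 𝓘(ℝ, B) 𝓘(ℝ, B) (α ∘ σ.toFun) x = mfderiv 𝓘(ℝ, B) 𝓘(ℝ, B) id x := by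
      apply Filter.EventuallyEq.mfderiv_eq
      filter_upwards [hU] with z hz using σ.section_eq z hz
    have h3 := h1.symm.trans h2
    rw [mfderiv_id] at h3
    exact congrArg (fun L : B →L[ℝ] B ↦ L v) h3

variable (B) in
/-- `w` is a PD-prehamiltonian system on `α` (`dim M = n + 1`): a `δ`-closed element of
`Ω²(P, α)`. -/
def IsPDPrehamiltonian (α : P → M) (n : ℕ) (w : FormField E P (n + 2)) : Prop :=
  IsAffineForm B α n 2 w ∧ w.d = 0

/-- `σ` is a solution of the PD-Hamilton equations `i_{σ̇} w|_σ = 0`. -/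
def IsSolution {α : P → M} (hα : ContMDiff 𝓘(ℝ, E) 𝓘(ℝ, B) ∞ α) {n : ℕ}
    (w : FormField E P (n + 2)) (σ : LocalSection B E α) : Prop :=
  ∀ (x : M) (hx : x ∈ σ.domain), (σ.jet hα x hx).insert (w (σ.toFun x)) = 0

variable (B) in
/-- `Y ∈ VD` and `f ∈ Ω⁰` are a PD-Noether symmetry and a PD-Noether current of `w`, relative to
each other: `i_Y w = δ f`. -/
def AreRelativePDNoether [IsManifold 𝓘(ℝ, E) ∞ P] (α : P → M) (n : ℕ)
    (w : FormField E P (n + 2)) (Y : ∀ y : P, TangentSpace 𝓘(ℝ, E) y)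
    (f : FormField E P n) : Prop :=
  IsVerticalVectorField B α Y ∧ IsAffineForm B α n 0 f ∧ w.insert Y = f.d

end PDHam

end

open Filter Topology

/-! On the domain of σ, d(σ^*f) = σ^*(df) = σ^*(i_Y ω). At x the last form sends v₁, …, vₙ to ω(Y,
dσ v₁, …, dσ vₙ), which vanishes by the PD-Hamilton equations because Y is vertical
(`IsSolution.pullback_insert_eq_zero`). The work lies in two facts about a σ that is smooth only on
an open set: σ^*f is smooth (`FormField.IsSmooth.pullback`) and d commutes with σ^*
(`FormField.IsSmooth.d_pullback`). Both reduce, via `FormField.inChart_pullback`, to pull-backs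
between vector spaces. -/

namespace ContinuousAlternatingMap

variable {F G H : Type*} [NormedAddCommGroup F] [NormedSpace ℝ F] [FiniteDimensional ℝ F]
  [NormedAddCommGroup G] [NormedSpace ℝ G]
  [NormedAddCommGroup H] [NormedSpace ℝ H] [FiniteDimensional ℝ H]

/-- On finite-dimensional spaces, the inclusion of alternating maps in multilinear maps has a
continuous linear left inverse. -/
theorem exists_leftInverse_toContinuousMultilinearMap (k : ℕ) :
    ∃ r : ContinuousMultilinearMap ℝ (fun _ : Fin k ↦ F) H →L[ℝ] F [⋀^Fin k]→L[ℝ] H,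
      ∀ η : F [⋀^Fin k]→L[ℝ] H, r η.toContinuousMultilinearMap = η := by
  -- Finite dimension makes the algebraic left inverse found below automatically continuous.
  have : FiniteDimensional ℝ (ContinuousMultilinearMap ℝ (fun _ : Fin k ↦ F) H) :=
    Module.Finite.of_injective
      (ContinuousMultilinearMap.toMultilinearMapLinear :
        ContinuousMultilinearMap ℝ (fun _ : Fin k ↦ F) H →ₗ[ℝ] _)
      ContinuousMultilinearMap.toMultilinearMap_injective
  obtain ⟨r, hr⟩ := LinearMap.exists_leftInverse_of_injective
    (toContinuousMultilinearMapCLM ℝ (𝕜 := ℝ) (E := F) (F := H) (ι := Fin k)).toLinearMap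
    (LinearMap.ker_eq_bot.2 toContinuousMultilinearMap_injective)
  exact ⟨r.toContinuousLinearMap, fun η ↦ congrArg (fun L ↦ L η) hr⟩

/-- The pull-back `η ↦ A^* η` is smooth as a function of `(η, A)`. -/
theorem contDiff_compContinuousLinearMap (k : ℕ) {r : WithTop ℕ∞} :
    ContDiff ℝ r (fun p : (G [⋀^Fin k]→L[ℝ] H) × (F →L[ℝ] G) ↦
      p.1.compContinuousLinearMap p.2) := by
  obtain ⟨ρ, hρ⟩ := exists_leftInverse_toContinuousMultilinearMap (F := F) (H := H) k
  -- As a multilinear map, A^*η is a continuous multilinear function of (A, …, A) applied to η,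
  -- hence smooth in both; ρ carries this back to alternating maps.
  have h₁ : ContDiff ℝ r (fun p : (G [⋀^Fin k]→L[ℝ] H) × (F →L[ℝ] G) ↦
      ContinuousMultilinearMap.compContinuousLinearMapContinuousMultilinear ℝ
        (fun _ : Fin k ↦ F) (fun _ : Fin k ↦ G) H (fun _ ↦ p.2)) :=
    (ContinuousMultilinearMap.contDiff _).comp (contDiff_pi.2 fun _ ↦ contDiff_snd)
  have h₂ : ContDiff ℝ r (fun p : (G [⋀^Fin k]→L[ℝ] H) × (F →L[ℝ] G) ↦
      toContinuousMultilinearMapCLM ℝ p.1) :=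
    (toContinuousMultilinearMapCLM (𝕜 := ℝ) (E := G) (F := H) (ι := Fin k) ℝ).contDiff.comp
      contDiff_fst
  have h₃ := ρ.contDiff.comp (h₁.clm_apply h₂)
  convert! h₃ using 1
  funext p
  exact (hρ (p.1.compContinuousLinearMap p.2)).symm

end ContinuousAlternatingMap

namespace PDHam

variable {B : Type*} [NormedAddCommGroup B] [NormedSpace ℝ B]
variable {D : Type*} [NormedAddCommGroup D] [NormedSpace ℝ D]
variable {E : Type*} [NormedAddCommGroup E] [NormedSpace ℝ E]
variable {M : Type*} [TopologicalSpace M] [ChartedSpace B M]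
variable {N : Type*} [TopologicalSpace N] [ChartedSpace D N]
variable {P : Type*} [TopologicalSpace P] [ChartedSpace E P]

/-- Makes functoriality of pull-backs available for chart expressions. -/
theorem FormField.inChart_eq_pullback {k : ℕ} (w : FormField E P k) (y : P) :
    w.inChart y = w.pullback E (extChartAt 𝓘(ℝ, E) y).symm :=
  rfl

theorem FormField.pullback_congr {k : ℕ} (w : FormField E P k) {σ τ : M → P} {x : M}
    (h : σ =ᶠ[𝓝 x] τ) : w.pullback B σ x = w.pullback B τ x := by
  -- The type of `w y` depends on y; with the derivatives typed as maps B → E, the equality of base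
  -- points can be substituted.
  have aux : ∀ (y y' : P) (L L' : B →L[ℝ] E), y = y' → L = L' →
      (w y : E [⋀^Fin k]→L[ℝ] ℝ).compContinuousLinearMap L =
        (w y' : E [⋀^Fin k]→L[ℝ] ℝ).compContinuousLinearMap L' := by
    rintro y _ L _ rfl rfl
    rfl
  exact aux _ _ _ _ h.self_of_nhds h.mfderiv_eq

theorem FormField.pullback_comp {k : ℕ} (w : FormField E P k) {σ : M → P} {τ : N → M} {x : N}
    (hσ : MDifferentiableAt 𝓘(ℝ, B) 𝓘(ℝ, E) σ (τ x))
    (hτ : MDifferentiableAt 𝓘(ℝ, D) 𝓘(ℝ, B) τ x) :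
    w.pullback D (σ ∘ τ) x = (w.pullback B σ).pullback D τ x := by
  unfold FormField.pullback
  rw [mfderiv_comp x hσ hτ]
  rfl

theorem contMDiffAt_extChartAt_symm [IsManifold 𝓘(ℝ, E) ∞ P] (y : P) {u : E}
    (hu : u ∈ (extChartAt 𝓘(ℝ, E) y).target) :
    ContMDiffAt 𝓘(ℝ, E) 𝓘(ℝ, E) ∞ (extChartAt 𝓘(ℝ, E) y).symm u :=
  (contMDiffOn_extChartAt_symm y).contMDiffAt ((isOpen_extChartAt_target y).mem_nhds hu)

theorem FormField.IsSmooth.contDiffAt_inChart {k : ℕ} {w : FormField E P k} (hw : w.IsSmooth)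
    (y : P) {u : E} (hu : u ∈ (extChartAt 𝓘(ℝ, E) y).target) :
    ContDiffAt ℝ ∞ (w.inChart y) u :=
  ((hw y).mono fun _ h ↦ ⟨h, mem_univ _⟩).contDiffAt ((isOpen_extChartAt_target y).mem_nhds hu)

/-- Tangent vectors at y are coordinatized by the preferred chart at y, whose derivative there is
therefore the identity. -/
theorem FormField.d_eq_extDeriv [IsManifold 𝓘(ℝ, E) ∞ P] {k : ℕ} (w : FormField E P k) (y : P) :
    w.d y = extDeriv (w.inChart y) (extChartAt 𝓘(ℝ, E) y y) := by
  have : IsManifold 𝓘(ℝ, E) 1 P := .of_le (n := ∞) (by simp)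
  have h : (mfderiv 𝓘(ℝ, E) 𝓘(ℝ, E) (extChartAt 𝓘(ℝ, E) y) y : E →L[ℝ] E) = .id ℝ E :=
    mfderiv_extChartAt_self
  exact congrArg (ContinuousAlternatingMap.compContinuousLinearMap (M := E) (M' := E)
    (extDeriv (w.inChart y) (extChartAt 𝓘(ℝ, E) y y))) h

/-! ### Pull-backs in charts: smoothness and naturality of d -/

section Charts

variable [IsManifold 𝓘(ℝ, B) ∞ M] [IsManifold 𝓘(ℝ, E) ∞ P]
variable {σ : M → P} {x₀ : M} {y₀ : P} {u : B}

theorem contDiffAt_inCharts (hu : u ∈ (extChartAt 𝓘(ℝ, B) x₀).target)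
    (hσ : ContMDiffAt 𝓘(ℝ, B) 𝓘(ℝ, E) ∞ σ ((extChartAt 𝓘(ℝ, B) x₀).symm u))
    (hy : σ ((extChartAt 𝓘(ℝ, B) x₀).symm u) ∈ (extChartAt 𝓘(ℝ, E) y₀).source) :
    ContDiffAt ℝ ∞ (extChartAt 𝓘(ℝ, E) y₀ ∘ σ ∘ (extChartAt 𝓘(ℝ, B) x₀).symm) u := by
  rw [extChartAt_source] at hy
  exact ((contMDiffAt_extChartAt' hy).comp u
    (hσ.comp u (contMDiffAt_extChartAt_symm x₀ hu))).contDiffAt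

/-- The expression of a pull-back in charts. -/
theorem FormField.inChart_pullback {k : ℕ} (w : FormField E P k)
    (hu : u ∈ (extChartAt 𝓘(ℝ, B) x₀).target)
    (hσ : ContMDiffAt 𝓘(ℝ, B) 𝓘(ℝ, E) ∞ σ ((extChartAt 𝓘(ℝ, B) x₀).symm u))
    (hy : σ ((extChartAt 𝓘(ℝ, B) x₀).symm u) ∈ (extChartAt 𝓘(ℝ, E) y₀).source) :
    (w.pullback B σ).inChart x₀ u =
      (w.inChart y₀ ((extChartAt 𝓘(ℝ, E) y₀ ∘ σ ∘ (extChartAt 𝓘(ℝ, B) x₀).symm) u)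
        ).compContinuousLinearMap
        (fderiv ℝ (extChartAt 𝓘(ℝ, E) y₀ ∘ σ ∘ (extChartAt 𝓘(ℝ, B) x₀).symm) u) := by
  have hφ := contMDiffAt_extChartAt_symm x₀ hu
  have hg := contDiffAt_inCharts hu hσ hy
  have hψ := contMDiffAt_extChartAt_symm y₀ ((extChartAt 𝓘(ℝ, E) y₀).map_source hy)
  have hcont : ContinuousAt (σ ∘ (extChartAt 𝓘(ℝ, B) x₀).symm) u := (hσ.comp u hφ).continuousAt
  -- With charts φ and ψ, σ ∘ φ⁻¹ = ψ⁻¹ ∘ (ψ ∘ σ ∘ φ⁻¹) near u; functoriality is then applied to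
  -- both factorizations.
  have heq : σ ∘ (extChartAt 𝓘(ℝ, B) x₀).symm =ᶠ[𝓝 u]
      (extChartAt 𝓘(ℝ, E) y₀).symm ∘
        (extChartAt 𝓘(ℝ, E) y₀ ∘ σ ∘ (extChartAt 𝓘(ℝ, B) x₀).symm) := by
    filter_upwards [hcont.preimage_mem_nhds ((isOpen_extChartAt_source y₀).mem_nhds hy)] with v hv
    exact ((extChartAt 𝓘(ℝ, E) y₀).left_inv hv).symm
  rw [FormField.inChart_eq_pullback, ← w.pullback_comp (hσ.mdifferentiableAt (by simp))
    (hφ.mdifferentiableAt (by simp)), w.pullback_congr heq,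
    ← mfderiv_eq_fderiv]
  exact w.pullback_comp (σ := (extChartAt 𝓘(ℝ, E) y₀).symm)
    (τ := extChartAt 𝓘(ℝ, E) y₀ ∘ σ ∘ (extChartAt 𝓘(ℝ, B) x₀).symm)
    (hψ.mdifferentiableAt (by simp)) (hg.contMDiffAt.mdifferentiableAt (by simp))

/-- Smoothness and `extDeriv` depend on germs, so the pointwise formula is needed on a
neighbourhood; its conditions are open. -/
theorem FormField.inChart_pullback_eventuallyEq {k : ℕ} (w : FormField E P k) {U : Set M}
    (hU : IsOpen U) (hσ : ContMDiffOn 𝓘(ℝ, B) 𝓘(ℝ, E) ∞ σ U)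
    (hu : u ∈ (extChartAt 𝓘(ℝ, B) x₀).target) (hxU : (extChartAt 𝓘(ℝ, B) x₀).symm u ∈ U)
    (hy : σ ((extChartAt 𝓘(ℝ, B) x₀).symm u) ∈ (extChartAt 𝓘(ℝ, E) y₀).source) :
    (w.pullback B σ).inChart x₀ =ᶠ[𝓝 u] fun v ↦
      (w.inChart y₀ ((extChartAt 𝓘(ℝ, E) y₀ ∘ σ ∘ (extChartAt 𝓘(ℝ, B) x₀).symm) v)
        ).compContinuousLinearMap
        (fderiv ℝ (extChartAt 𝓘(ℝ, E) y₀ ∘ σ ∘ (extChartAt 𝓘(ℝ, B) x₀).symm) v) := by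
  have hφ : ContinuousAt (extChartAt 𝓘(ℝ, B) x₀).symm u :=
    (contMDiffAt_extChartAt_symm x₀ hu).continuousAt
  have hσu : ContinuousAt σ ((extChartAt 𝓘(ℝ, B) x₀).symm u) :=
    (hσ.contMDiffAt (hU.mem_nhds hxU)).continuousAt
  filter_upwards [(isOpen_extChartAt_target x₀).mem_nhds hu,
    hφ.preimage_mem_nhds (hU.mem_nhds hxU),
    (hσu.comp hφ).preimage_mem_nhds ((isOpen_extChartAt_source y₀).mem_nhds hy)] with v h₁ h₂ h₃
  exact w.inChart_pullback h₁ (hσ.contMDiffAt (hU.mem_nhds h₂)) h₃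

/-- The pull-back of a differential form along a map that is smooth on an open set is smooth
there. -/
theorem FormField.IsSmooth.pullback [FiniteDimensional ℝ B] {k : ℕ} {w : FormField E P k}
    (hw : w.IsSmooth) {U : Set M} (hU : IsOpen U) (hσ : ContMDiffOn 𝓘(ℝ, B) 𝓘(ℝ, E) ∞ σ U) :
    (w.pullback B σ).IsSmoothOn U := by
  rintro x₀ u ⟨hu, hxU⟩
  have hy := mem_extChartAt_source (I := 𝓘(ℝ, E)) (σ ((extChartAt 𝓘(ℝ, B) x₀).symm u))
  have hg := contDiffAt_inCharts hu (hσ.contMDiffAt (hU.mem_nhds hxU)) hy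
  have h₁ := (hw.contDiffAt_inChart _ ((extChartAt 𝓘(ℝ, E) _).map_source hy)).comp u hg
  have h₂ := hg.fderiv_right (m := ∞) (by simp)
  exact ((ContinuousAlternatingMap.contDiff_compContinuousLinearMap k).contDiffAt.comp u
    (h₁.prodMk h₂)).congr_of_eventuallyEq
      (w.inChart_pullback_eventuallyEq hU hσ hu hxU hy) |>.contDiffWithinAt

/-- The de Rham differential commutes with pull-backs. -/
theorem FormField.IsSmooth.d_pullback {k : ℕ} {w : FormField E P k} (hw : w.IsSmooth)
    {U : Set M} (hU : IsOpen U) (hσ : ContMDiffOn 𝓘(ℝ, B) 𝓘(ℝ, E) ∞ σ U) {x : M} (hx : x ∈ U) :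
    (w.pullback B σ).d x = w.d.pullback B σ x := by
  have hleft : (extChartAt 𝓘(ℝ, B) x).symm (extChartAt 𝓘(ℝ, B) x x) = x := extChartAt_to_inv x
  have hu := mem_extChartAt_target (I := 𝓘(ℝ, B)) x
  have hσx := hσ.contMDiffAt (hU.mem_nhds hx)
  have hxU : (extChartAt 𝓘(ℝ, B) x).symm (extChartAt 𝓘(ℝ, B) x x) ∈ U := by rwa [hleft]
  have hy : σ ((extChartAt 𝓘(ℝ, B) x).symm (extChartAt 𝓘(ℝ, B) x x)) ∈
      (extChartAt 𝓘(ℝ, E) (σ x)).source := by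
    rw [hleft]; exact mem_extChartAt_source _
  have hg := contDiffAt_inCharts hu (by rwa [hleft]) hy
  have hgu : (extChartAt 𝓘(ℝ, E) (σ x) ∘ σ ∘ (extChartAt 𝓘(ℝ, B) x).symm)
      (extChartAt 𝓘(ℝ, B) x x) = extChartAt 𝓘(ℝ, E) (σ x) (σ x) := by
    simp only [Function.comp_apply, hleft]
  -- `mfderiv` is by definition the derivative in the preferred charts at x and σ x, which are the
  -- ones used here.
  have hderiv : (fderiv ℝ (extChartAt 𝓘(ℝ, E) (σ x) ∘ σ ∘ (extChartAt 𝓘(ℝ, B) x).symm)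
      (extChartAt 𝓘(ℝ, B) x x) : B →L[ℝ] E) = mfderiv 𝓘(ℝ, B) 𝓘(ℝ, E) σ x := by
    rw [(hσx.mdifferentiableAt (by simp)).mfderiv]
    simp [writtenInExtChartAt, fderivWithin_univ]
  have key : extDeriv ((w.pullback B σ).inChart x) (extChartAt 𝓘(ℝ, B) x x) =
      (extDeriv (w.inChart (σ x)) (extChartAt 𝓘(ℝ, E) (σ x) (σ x))).compContinuousLinearMap
        (mfderiv 𝓘(ℝ, B) 𝓘(ℝ, E) σ x : B →L[ℝ] E) := by
    rw [(w.inChart_pullback_eventuallyEq hU hσ hu hxU hy).extDeriv_eq,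
      extDeriv_pullback (r := ∞) ?_ hg (by
        rw [minSmoothness_of_isRCLikeNormedField]; exact WithTop.coe_le_coe.2 (le_top : (2 : ℕ∞) ≤ ⊤)),
      hderiv, hgu]
    · rfl
    rw [hgu]
    exact (hw.contDiffAt_inChart _ (mem_extChartAt_target _)).differentiableAt (by simp)
  rw [FormField.d_eq_extDeriv]
  refine key.trans ?_
  unfold FormField.pullback
  rw [FormField.d_eq_extDeriv]
  rfl

end Charts

/-- Along a solution, the contraction of the system with a vertical vector field pulls back to
zero. -/
theorem IsSolution.pullback_insert_eq_zero {α : P → M} {hα : ContMDiff 𝓘(ℝ, E) 𝓘(ℝ, B) ∞ α}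
    {n : ℕ} {w : FormField E P (n + 2)} {σ : LocalSection B E α} (hσ : IsSolution hα w σ)
    {Y : ∀ y : P, TangentSpace 𝓘(ℝ, E) y} (hY : ∀ y, Y y ∈ verticalSpace B α y)
    {x : M} (hx : x ∈ σ.domain) : (w.insert Y).pullback B σ.toFun x = 0 :=
  -- The equation at x is an equality of functions on vertical vectors; its value at Y(σ x) is, by
  -- unfolding, the pull-back.
  congrFun (hσ x hx) ⟨Y (σ.toFun x), hY _⟩

end PDHam

theorem mainTheorem2 (n m : ℕ)
    {M : Type*} [TopologicalSpace M] [T2Space M] [SecondCountableTopology M]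
    [ChartedSpace (EuclideanSpace ℝ (Fin (n + 1))) M] [IsManifold (𝓡 (n + 1)) ∞ M]
    {P : Type*} [TopologicalSpace P] [T2Space P] [SecondCountableTopology P]
    [ChartedSpace (EuclideanSpace ℝ (Fin (n + 1 + m))) P] [IsManifold (𝓡 (n + 1 + m)) ∞ P]
    {F : Type*} [TopologicalSpace F] [T2Space F] [SecondCountableTopology F]
    [ChartedSpace (EuclideanSpace ℝ (Fin m)) F] [IsManifold (𝓡 m) ∞ F]
    (α : P → M) (hα : PDHam.IsSmoothFiberBundle (EuclideanSpace ℝ (Fin (n + 1))) (EuclideanSpace ℝ (Fin (n + 1 + m)))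
      (EuclideanSpace ℝ (Fin m)) F α)
    (w : PDHam.FormField (EuclideanSpace ℝ (Fin (n + 1 + m))) P (n + 2))
    (hw : PDHam.IsPDPrehamiltonian (EuclideanSpace ℝ (Fin (n + 1))) α n w)
    (Y : ∀ y : P, TangentSpace (𝓡 (n + 1 + m)) y)
    (f : PDHam.FormField (EuclideanSpace ℝ (Fin (n + 1 + m))) P n)
    (hYf : PDHam.AreRelativePDNoether (EuclideanSpace ℝ (Fin (n + 1))) α n w Y f)
    (σ : PDHam.LocalSection (EuclideanSpace ℝ (Fin (n + 1))) (EuclideanSpace ℝ (Fin (n + 1 + m))) α) (hσ : PDHam.IsSolution hα.smooth w σ) :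
    (f.pullback (EuclideanSpace ℝ (Fin (n + 1))) σ.toFun).IsClosedOn (σ.domain : Set M) :=
  ⟨hYf.2.1.1.pullback σ.domain.isOpen σ.smooth, fun x hx ↦ by
    rw [hYf.2.1.1.d_pullback σ.domain.isOpen σ.smooth hx, ← hYf.2.2]
    exact hσ.pullback_insert_eq_zero hYf.1.2 hx⟩
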